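/- Let $I=[0,1]$ and let $\mathrm{Homeo}^+(I)$ be the group of orientation-preserving homeomorphisms of $I$. Consider the subgroups $G\leq \mathrm{Homeo}^+(I)$ for which there are elements $a,b,c$ (not necessarily distinct) with $G=\langle a,b,c\rangle$ such that the subgroup $\langle a^2,b^2,c^2\rangle$ is cyclic. These subgroups $G$ fall into uncountably many isomorphism types of abstract groups. Moreover, at least one such subgroup $G$ contains a nonabelian free group. -/

import Mathlib

/-- `Homeo⁺(I)`: the group, under composition, of the orientation-preserving (that is, increasing)
homeomorphisms of the unit interval `I = [0, 1]`, inside the group of all homeomorphisms of `I`. -/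
def HomeoPlus : Subgroup (unitInterval ≃ₜ unitInterval) where
  carrier := {f | StrictMono f}
  mul_mem' := fun {_ _} hf hg => hf.comp hg
  one_mem' := strictMono_id
  inv_mem' := by
    intro f hf x y hxy
    replace hf : StrictMono f := hf
    have h : f (f.symm x) < f (f.symm y) := by simpa using hxy
    exact hf.lt_iff_lt.1 h

/-- The subgroup `G` is generated by three elements whose squares generate a cyclic group. -/
def IsThreeGeneratedWithCyclicSquares {Γ : Type*} [Group Γ] (G : Subgroup Γ) : Prop :=
  ∃ a b c : Γ, G = Subgroup.closure {a, b, c} ∧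
    IsCyclic (Subgroup.closure ({a ^ 2, b ^ 2, c ^ 2} : Set Γ))

/-- The relation of being isomorphic as abstract groups, on the subgroups of `Γ`. -/
def subgroupIsoSetoid (Γ : Type*) [Group Γ] : Setoid (Subgroup Γ) where
  r G H := Nonempty (G ≃* H)
  iseqv :=
    { refl := fun G => ⟨MulEquiv.refl G⟩
      symm := fun ⟨e⟩ => ⟨e.symm⟩
      trans := fun ⟨e⟩ ⟨e'⟩ => ⟨e.trans e'⟩ }

/-- The isomorphism type of a subgroup of `Γ`. -/
def isoType {Γ : Type*} [Group Γ] (G : Subgroup Γ) : Quotient (subgroupIsoSetoid Γ) :=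
  Quotient.mk (subgroupIsoSetoid Γ) G

/-- The subgroup `G` contains a nonabelian free group. -/
def ContainsNonabelianFreeGroup {Γ : Type*} [Group Γ] (G : Subgroup Γ) : Prop :=
  ∃ K : Subgroup Γ, K ≤ G ∧ IsFreeGroup K ∧ ¬ ∀ x y : K, x * y = y * x

/-! Identify $(0,1)$ with the line and let $a$ be translation by 1. Given $f,g\in\mathrm{Aut}(I)$,
let $\tilde f$ act on the block $[n,n+1)$ as $f$ for even $n$ and as $f^{-1}$ for odd $n$.
Conjugation by $a$ inverts $\tilde f$, so $(a\tilde f)^2=a^2$: the triple $a,a\tilde f,a\tilde g$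
has a single square (`translation_mul_blockAut_alternating_sq`), while $f,g$ remain arbitrary.

Uncountability: for $S\subseteq\mathbb N$, choose $f,g$ so that $g$ commutes with
$f^{m+1}gf^{-(m+1)}$ exactly when $m\notin S$ (`lift_commutatorWord_markedFamily`). The relations of
the triple then recover $S$, and a countable group has only countably many triples
(`not_countable_isoType`).

Free subgroup: take $f,g$ to be a ping-pong pair (`lift_pingPongPair_injective`). -/

open Set unitInterval

/-! ### Extending automorphisms of the line to $I$ -/

/-- An action by strictly increasing permutations, as a homomorphism to the order
automorphisms. -/
def MonoidHom.toOrderAut {G α : Type*} [Group G] [LinearOrder α] (φ : G →* Equiv.Perm α)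
    (h : ∀ g, StrictMono (φ g)) : G →* (α ≃o α) where
  toFun g := ⟨φ g, (h g).le_iff_le⟩
  map_one' := by ext x; simp
  map_mul' g g' := by ext x; simp

/-- The real line is order isomorphic to the open unit interval, viewed inside `I`. -/
noncomputable def realOrderIsoIoo : ℝ ≃o {x : I // x ∈ Ioo (0 : I) 1} :=
  (unitInterval.sigmoid_strictMono.orderIso unitInterval.sigmoid).trans
    (OrderIso.setCongr _ _ unitInterval.range_sigmoid)

open Classical in
/-- Extension of permutations of the line to `I`, by the identity at the end points. -/
noncomputable def extendPerm : (ℝ ≃o ℝ) →* Equiv.Perm I :=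
  Equiv.Perm.ofSubtype.comp
    { toFun := fun f => ((realOrderIsoIoo.symm.trans f).trans realOrderIsoIoo).toEquiv
      map_one' := by ext x; simp
      map_mul' := fun f g => by ext x; simp }

lemma extendPerm_coe (f : ℝ ≃o ℝ) (x : {x : I // x ∈ Ioo (0 : I) 1}) :
    extendPerm f x = realOrderIsoIoo (f (realOrderIsoIoo.symm x)) := by
  simp [extendPerm, -Subtype.coe_eta]

lemma extendPerm_of_notMem (f : ℝ ≃o ℝ) {x : I} (hx : x ∉ Ioo (0 : I) 1) :
    extendPerm f x = x := by
  classical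
  simp only [extendPerm, MonoidHom.comp_apply]
  exact Equiv.Perm.ofSubtype_apply_of_not_mem _ hx

lemma extendPerm_injective : Function.Injective extendPerm := by
  intro f g h
  ext x
  have := congrArg (fun p : Equiv.Perm I => p (realOrderIsoIoo x)) h
  simp only [extendPerm_coe, OrderIso.symm_apply_apply] at this
  exact realOrderIsoIoo.injective (Subtype.ext this)

lemma extendPerm_strictMono (f : ℝ ≃o ℝ) : StrictMono (extendPerm f) := by
  have mem : ∀ x ∈ Ioo (0 : I) 1, extendPerm f x ∈ Ioo (0 : I) 1 := fun x hx => by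
    rw [extendPerm_coe f ⟨x, hx⟩]; exact Subtype.prop _
  have ends : ∀ x : I, x ∉ Ioo (0 : I) 1 → x = 0 ∨ x = 1 := fun x hx => by
    by_contra! h
    exact hx ⟨unitInterval.pos_iff_ne_zero.2 h.1, unitInterval.lt_one_iff_ne_one.2 h.2⟩
  intro x y hxy
  by_cases hx : x ∈ Ioo (0 : I) 1 <;> by_cases hy : y ∈ Ioo (0 : I) 1
  · rw [extendPerm_coe f ⟨x, hx⟩, extendPerm_coe f ⟨y, hy⟩]
    simpa using hxy
  · rw [extendPerm_of_notMem f hy]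
    rcases ends y hy with rfl | rfl
    · exact absurd hxy (not_lt_of_ge unitInterval.nonneg')
    · exact (mem x hx).2
  · rw [extendPerm_of_notMem f hx]
    rcases ends x hx with rfl | rfl
    · exact (mem y hy).1
    · exact absurd hxy (not_lt_of_ge unitInterval.le_one')
  · rwa [extendPerm_of_notMem f hx, extendPerm_of_notMem f hy]

/-- Extension of automorphisms of the line to `I`, by the identity at the end points. -/
noncomputable def extendAut : (ℝ ≃o ℝ) →* (I ≃o I) :=
  extendPerm.toOrderAut extendPerm_strictMono

lemma extendAut_injective : Function.Injective extendAut := fun _ _ h =>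
  extendPerm_injective (Equiv.ext fun x => DFunLike.congr_fun h x)

/-- Order automorphisms of `I` as elements of `HomeoPlus`. -/
def autToHomeoPlus : (I ≃o I) →* HomeoPlus where
  toFun f := ⟨f.toHomeomorph, f.strictMono⟩
  map_one' := by ext x; simp
  map_mul' f g := by ext x; simp

lemma autToHomeoPlus_injective : Function.Injective autToHomeoPlus := fun f g h => by
  ext x
  exact congrArg Subtype.val (DFunLike.congr_fun (congrArg Subtype.val h) x)

/-! ### Block actions and translations on the line -/

/-- The element `n` of the family `h` acts on the block `[n, n + 1)` of the line. -/
noncomputable def blockMap (h : ℤ → (I ≃o I)) (x : ℝ) : ℝ :=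
  ⌊x⌋ + h ⌊x⌋ ⟨Int.fract x, Int.fract_nonneg x, (Int.fract_lt_one x).le⟩

lemma blockMap_int_add (h : ℤ → (I ≃o I)) (n : ℤ) (y : I) (hy : y < 1) :
    blockMap h (n + y) = n + h n y := by
  have hy' : (y : ℝ) < 1 := hy
  have hf : ⌊(n + y : ℝ)⌋ = n := by
    rw [Int.floor_eq_iff]; exact ⟨by linarith [y.2.1], by linarith⟩
  unfold blockMap
  have : Int.fract (n + y : ℝ) = y := by rw [Int.fract, hf]; ring
  simp only [hf, this]

lemma orderAut_lt_one (f : I ≃o I) {y : I} (hy : y < 1) : f y < 1 := by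
  have : f 1 = 1 := f.map_top
  rw [← this]; exact f.strictMono hy

lemma exists_int_add (x : ℝ) : ∃ (n : ℤ) (y : I), y < 1 ∧ x = n + y :=
  ⟨⌊x⌋, ⟨Int.fract x, Int.fract_nonneg x, (Int.fract_lt_one x).le⟩, Int.fract_lt_one x,
    (Int.floor_add_fract x).symm⟩

/-- `blockMap` as a homomorphism. -/
noncomputable def blockPerm : (ℤ → (I ≃o I)) →* Equiv.Perm ℝ :=
  MonoidHom.toHomPerm
    { toFun := blockMap
      map_one' := by
        funext x
        obtain ⟨n, y, hy, rfl⟩ := exists_int_add x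
        simp [blockMap_int_add _ _ _ hy, Function.End.one_def]
      map_mul' := fun h h' => by
        funext x
        obtain ⟨n, y, hy, rfl⟩ := exists_int_add x
        change _ = blockMap h (blockMap h' _)
        rw [blockMap_int_add _ _ _ hy, blockMap_int_add _ _ _ hy,
          blockMap_int_add _ _ _ (orderAut_lt_one _ hy)]
        simp }

lemma blockMap_strictMono (h : ℤ → (I ≃o I)) : StrictMono (blockMap h) := by
  intro x x' hx
  obtain ⟨n, y, hy, rfl⟩ := exists_int_add x
  obtain ⟨n', y', hy', rfl⟩ := exists_int_add x'
  rw [blockMap_int_add _ _ _ hy, blockMap_int_add _ _ _ hy']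
  have h1 : (h n y : ℝ) < 1 := orderAut_lt_one _ hy
  have h2 : (y' : ℝ) < 1 := hy'
  rcases lt_trichotomy n n' with hn | rfl | hn
  · have : (n : ℝ) + 1 ≤ n' := by exact_mod_cast hn
    linarith [(h n' y').2.1]
  · have : y < y' := by
      change (y : ℝ) < y'
      linarith
    have : (h n y : ℝ) < h n y' := (h n).strictMono this
    linarith
  · have : (n' : ℝ) + 1 ≤ n := by exact_mod_cast hn
    linarith [y.2.1]

/-- The action of `ℤ → Aut I` on the line, block by block. -/
noncomputable def blockAut : (ℤ → (I ≃o I)) →* (ℝ ≃o ℝ) :=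
  blockPerm.toOrderAut blockMap_strictMono

lemma blockAut_int_add (h : ℤ → (I ≃o I)) (n : ℤ) (y : I) (hy : y < 1) :
    blockAut h (n + y) = n + h n y := blockMap_int_add h n y hy

lemma blockAut_injective : Function.Injective blockAut := fun h h' H => by
  funext n
  ext y
  rcases eq_or_lt_of_le (unitInterval.le_one' : y ≤ 1) with rfl | hy
  · have (f : I ≃o I) : f 1 = 1 := f.map_top
    rw [this, this]
  · have := DFunLike.congr_fun H ((n : ℝ) + y)
    rw [blockAut_int_add _ _ _ hy, blockAut_int_add _ _ _ hy] at this
    linarith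

/-- Translation of the line by `c`. -/
noncomputable def translation (c : ℝ) : ℝ ≃o ℝ := OrderIso.addRight c

@[simp] lemma translation_apply (c x : ℝ) : translation c x = x + c := rfl

lemma translation_mul (c d : ℝ) : translation c * translation d = translation (c + d) := by
  ext x; simp; ring

lemma translation_inv (c : ℝ) : (translation c)⁻¹ = translation (-c) :=
  inv_eq_of_mul_eq_one_right (by rw [translation_mul]; ext; simp)

lemma translation_one_pow (k : ℕ) : translation 1 ^ k = translation k := by
  induction k with
  | zero => ext; simp
  | succ k ih => rw [pow_succ, ih, translation_mul]; push_cast; rfl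

lemma translation_conj_blockAut (m : ℤ) (h : ℤ → (I ≃o I)) :
    translation m * blockAut h * (translation m)⁻¹ = blockAut fun n => h (n - m) := by
  rw [translation_inv]
  ext x
  obtain ⟨n, y, hy, rfl⟩ := exists_int_add x
  have : (n + y + -m : ℝ) = ((n - m : ℤ) : ℝ) + y := by push_cast; ring
  simp only [RelIso.mul_apply, translation_apply, this, blockAut_int_add _ _ _ hy]
  push_cast; ring

/-! ### Marked groups and isomorphism types -/

instance FreeGroup.countable_closure_range {Γ ι : Type*} [Group Γ] [Countable ι] (t : ι → Γ) :
    Countable (Subgroup.closure (range t)) := by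
  rw [← FreeGroup.range_lift_eq_closure]
  exact (FreeGroup.lift t).rangeRestrict_surjective.countable

/-- The generating tuple `t`, inside the subgroup that it generates. -/
def closureTuple {Γ ι : Type*} [Group Γ] (t : ι → Γ) (i : ι) : Subgroup.closure (range t) :=
  ⟨t i, Subgroup.subset_closure (mem_range_self i)⟩

lemma lift_closureTuple_eq_one {Γ ι : Type*} [Group Γ] (t : ι → Γ) (w : FreeGroup ι) :
    FreeGroup.lift (closureTuple t) w = 1 ↔ FreeGroup.lift t w = 1 := by
  have : FreeGroup.lift t = (Subgroup.subtype _).comp (FreeGroup.lift (closureTuple t)) := by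
    ext i; simp [closureTuple]
  rw [this, MonoidHom.comp_apply, Subgroup.subtype_apply, OneMemClass.coe_eq_one]

/-- A countable group has countably many generating tuples of a given finite length, so
uncountably many marked groups give uncountably many isomorphism types. -/
lemma not_countable_isoType {Γ ι κ : Type*} [Group Γ] [Finite ι] [Uncountable κ]
    (P : Set (Subgroup Γ)) (t : κ → ι → Γ) (hP : ∀ s, Subgroup.closure (range (t s)) ∈ P)
    (sep : ∀ s s', (∀ w, FreeGroup.lift (t s) w = 1 ↔ FreeGroup.lift (t s') w = 1) → s = s') :
    ¬ (isoType '' P).Countable := by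
  intro hc
  let T : κ → Quotient (subgroupIsoSetoid Γ) := fun s => isoType (Subgroup.closure (range (t s)))
  have fiber : ∀ q, (T ⁻¹' {q}).Countable := by
    intro q
    rcases (T ⁻¹' {q}).eq_empty_or_nonempty with h | ⟨s₀, hs₀⟩
    · rw [h]; exact countable_empty
    · have iso : ∀ s : T ⁻¹' {q},
          Nonempty (Subgroup.closure (range (t s.1)) ≃* Subgroup.closure (range (t s₀))) :=
        fun s => Quotient.exact ((show T s = q from s.2).trans (show T s₀ = q from hs₀).symm)
      let e : ∀ s : T ⁻¹' {q},
          Subgroup.closure (range (t s)) ≃* Subgroup.closure (range (t s₀)) :=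
        fun s => (iso s).some
      have key : ∀ (s : T ⁻¹' {q}) w,
          FreeGroup.lift (fun i => e s (closureTuple (t s) i)) w = 1 ↔
            FreeGroup.lift (t s) w = 1 := by
        intro s w
        have : FreeGroup.lift (fun i => e s (closureTuple (t s) i)) =
            (e s).toMonoidHom.comp (FreeGroup.lift (closureTuple (t s))) := by ext i; simp
        rw [this, ← lift_closureTuple_eq_one]
        simp
      -- The image tuple lies in one fixed countable group and satisfies the same relations as `t
      -- s`, so by `sep` it determines `s`.
      refine Function.Injective.countable (f := fun s i => e s (closureTuple (t s) i)) ?_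
      intro s s' h
      refine Subtype.ext (sep _ _ fun w => ?_)
      rw [← key s, ← key s']
      simp only at h
      rw [h]
  refine not_countable_univ (α := κ) ((hc.biUnion fun q _ => fiber q).mono fun s _ => ?_)
  exact mem_biUnion (mem_image_of_mem _ (hP s)) rfl

/-! ### Triples with a common square -/

/-- The family with `f` on even blocks and its inverse on odd blocks. -/
def alternating {A : Type*} [Group A] (f : A) (n : ℤ) : A := if Even n then f else f⁻¹

lemma alternating_sub_one {A : Type*} [Group A] (f : A) (n : ℤ) :
    alternating f (n - 1) = (alternating f n)⁻¹ := by
  by_cases h : Even n <;> simp [alternating, h]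

/-- Odd blocks carry inverses: there the condition amounts to $g$ commuting with its conjugate by
$f^{-k}$. As `h` equates this with the condition on even blocks, block 0 decides. -/
lemma commute_alternating_iff {A : Type*} [Group A] {f g : A} {k : ℕ}
    (h : Commute g (f ^ k * g * (f ^ k)⁻¹) ↔ Commute g ((f ^ k)⁻¹ * g * f ^ k)) :
    Commute (alternating g)
      (alternating f ^ k * alternating g * (alternating f ^ k)⁻¹) ↔
      Commute g (f ^ k * g * (f ^ k)⁻¹) := by
  constructor
  · intro H
    have h0 := congrFun H 0
    simp only [alternating, Pi.mul_apply, Pi.pow_apply, Pi.inv_apply, Even.zero, if_true] at h0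
    exact h0
  · intro H
    funext n
    by_cases hn : Even n
    · simpa only [alternating, Pi.mul_apply, Pi.pow_apply, Pi.inv_apply, hn, if_true] using H.eq
    · have := (h.1 H).inv_inv.eq
      simpa [alternating, hn, mul_assoc] using this

/-- The homeomorphism of `I` induced by an automorphism of the line. -/
noncomputable def lineToHomeoPlus : (ℝ ≃o ℝ) →* HomeoPlus := autToHomeoPlus.comp extendAut

lemma lineToHomeoPlus_injective : Function.Injective lineToHomeoPlus :=
  autToHomeoPlus_injective.comp extendAut_injective

/-- Three elements of `HomeoPlus` with the same square, built from two automorphisms of `I`. -/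
noncomputable def equalSquaresTriple (f g : I ≃o I) : Fin 3 → HomeoPlus :=
  ![lineToHomeoPlus (translation 1),
    lineToHomeoPlus (translation 1 * blockAut (alternating f)),
    lineToHomeoPlus (translation 1 * blockAut (alternating g))]

lemma translation_mul_blockAut_alternating_sq (f : I ≃o I) :
    (translation 1 * blockAut (alternating f)) ^ 2 = translation 1 ^ 2 := by
  have h := translation_conj_blockAut 1 (alternating f)
  simp only [Int.cast_one, alternating_sub_one] at h
  have h' : translation 1 * blockAut (alternating f) * (translation 1)⁻¹ =
      (blockAut (alternating f))⁻¹ := by rw [h, ← map_inv]; rfl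
  generalize translation 1 = a at h' ⊢
  generalize blockAut (alternating f) = b at h' ⊢
  have h'' : a * b = b⁻¹ * a := mul_inv_eq_iff_eq_mul.1 h'
  have h3 : b * a * b = a := by rw [mul_assoc, h'', mul_inv_cancel_left]
  rw [sq, sq, mul_assoc, ← mul_assoc b, h3]

lemma range_equalSquaresTriple (f g : I ≃o I) :
    range (equalSquaresTriple f g) = {lineToHomeoPlus (translation 1),
    lineToHomeoPlus (translation 1 * blockAut (alternating f)),
    lineToHomeoPlus (translation 1 * blockAut (alternating g))} := by
  rw [equalSquaresTriple, Matrix.range_cons, Matrix.range_cons_cons_empty]; rfl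

lemma isThreeGeneratedWithCyclicSquares_equalSquaresTriple (f g : I ≃o I) :
    IsThreeGeneratedWithCyclicSquares (Subgroup.closure (range (equalSquaresTriple f g))) := by
  refine ⟨_, _, _, congrArg _ (range_equalSquaresTriple f g), ?_⟩
  rw [← map_pow, ← map_pow, ← map_pow, translation_mul_blockAut_alternating_sq,
    translation_mul_blockAut_alternating_sq, insert_eq_of_mem (mem_insert _ _), pair_eq_singleton,
    ← Subgroup.zpowers_eq_closure]
  infer_instance

/-- The action of `ℤ → Aut I` on `I`, block by block. -/
noncomputable def blockToHomeoPlus : (ℤ → (I ≃o I)) →* HomeoPlus := lineToHomeoPlus.comp blockAut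

lemma blockToHomeoPlus_injective : Function.Injective blockToHomeoPlus :=
  lineToHomeoPlus_injective.comp blockAut_injective

lemma equalSquaresTriple_zero_inv_mul_one (f g : I ≃o I) :
    (equalSquaresTriple f g 0)⁻¹ * equalSquaresTriple f g 1 = blockToHomeoPlus (alternating f) := by
  simp [equalSquaresTriple, blockToHomeoPlus]

lemma equalSquaresTriple_zero_inv_mul_two (f g : I ≃o I) :
    (equalSquaresTriple f g 0)⁻¹ * equalSquaresTriple f g 2 = blockToHomeoPlus (alternating g) := by
  simp [equalSquaresTriple, blockToHomeoPlus]

/-! ### Relations that encode a subset of $\mathbb N$ -/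

/-- The commutator of `y` and `x ^ k * y * x ^ (-k)`. -/
def conjCommutator {A : Type*} [Group A] (k : ℕ) (x y : A) : A :=
  y * (x ^ k * y * (x ^ k)⁻¹) * ((x ^ k * y * (x ^ k)⁻¹) * y)⁻¹

lemma conjCommutator_eq_one {A : Type*} [Group A] {k : ℕ} {x y : A} :
    conjCommutator k x y = 1 ↔ Commute y (x ^ k * y * (x ^ k)⁻¹) := mul_inv_eq_one

lemma map_conjCommutator {A B : Type*} [Group A] [Group B] (φ : A →* B) (k : ℕ) (x y : A) :
    φ (conjCommutator k x y) = conjCommutator k (φ x) (φ y) := by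
  simp [conjCommutator]

/-- The word `conjCommutator k f g`, where the letters stand for `a`, `a * f` and `a * g`. -/
def commutatorWord (k : ℕ) : FreeGroup (Fin 3) :=
  conjCommutator k ((FreeGroup.of 0)⁻¹ * FreeGroup.of 1) ((FreeGroup.of 0)⁻¹ * FreeGroup.of 2)

lemma lift_commutatorWord_eq_one (f g : I ≃o I) (k : ℕ) :
    FreeGroup.lift (equalSquaresTriple f g) (commutatorWord k) = 1 ↔
      Commute (alternating g)
        (alternating f ^ k * alternating g * (alternating f ^ k)⁻¹) := by
  rw [commutatorWord, map_conjCommutator]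
  simp only [map_mul, map_inv, FreeGroup.lift_apply_of, equalSquaresTriple_zero_inv_mul_one,
    equalSquaresTriple_zero_inv_mul_two]
  rw [← map_conjCommutator, map_eq_one_iff _ blockToHomeoPlus_injective, conjCommutator_eq_one]

/-- The family carrying `p` at `0` and `q` at `n + 1` for `n ∈ S`. -/
noncomputable def markedFamily {A : Type*} [Group A] (p q : A) (S : Set ℕ) (n : ℤ) : A :=
  open Classical in if n = 0 then p else if ∃ m ∈ S, n = m + 1 then q else 1

lemma markedFamily_zero {A : Type*} [Group A] (p q : A) (S : Set ℕ) :
    markedFamily p q S 0 = p := by simp [markedFamily]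

lemma markedFamily_of_neg {A : Type*} [Group A] (p q : A) (S : Set ℕ) {n : ℤ} (hn : n < 0) :
    markedFamily p q S n = 1 := by
  rw [markedFamily, if_neg hn.ne, if_neg]
  rintro ⟨m, -, rfl⟩
  omega

lemma markedFamily_add_one {A : Type*} [Group A] (p q : A) (S : Set ℕ) (m : ℕ) :
    markedFamily p q S (m + 1) = open Classical in if m ∈ S then q else 1 := by
  rw [markedFamily, if_neg (by omega)]
  congr 1
  simp

/-- The shift moves `p` from 0 to `m + 1`, the only place where it can meet a `q`. To the left the
shifted family is trivial; to the right both entries lie in `{q, 1}`. -/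
lemma commute_markedFamily_iff {A : Type*} [Group A] {p q : A} (hpq : ¬ Commute p q)
    (S : Set ℕ) (m : ℕ) :
    (∀ n, Commute (markedFamily p q S n) (markedFamily p q S (n - (m + 1)))) ↔ m ∉ S := by
  constructor
  · intro h hm
    have := h (m + 1)
    rw [sub_self, markedFamily_zero, markedFamily_add_one, if_pos hm] at this
    exact hpq this.symm
  · intro hm n
    rcases lt_trichotomy (n - (m + 1)) 0 with hn | hn | hn
    · rw [markedFamily_of_neg p q S hn]; exact Commute.one_right _
    · obtain rfl : n = m + 1 := by omega
      rw [markedFamily_add_one, if_neg hm]; exact Commute.one_left _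
    · obtain ⟨i, hi⟩ : ∃ i : ℕ, n - (m + 1) = i + 1 :=
        ⟨(n - (m + 1) - 1).toNat, by omega⟩
      obtain rfl : n = ((i + m + 1 : ℕ) : ℤ) + 1 := by push_cast; omega
      rw [hi, markedFamily_add_one, markedFamily_add_one]
      split_ifs <;> simp

lemma exists_not_commute : ∃ p q : I ≃o I, ¬ Commute p q := by
  refine ⟨extendAut (translation 1), extendAut (OrderIso.mulRight₀ 2 two_pos), fun h => ?_⟩
  have h' := extendAut_injective (((map_mul ..).trans h).trans (map_mul ..).symm)
  -- The two compositions of $x\mapsto x+1$ and $x\mapsto 2x$ send 0 to 1 and to 2.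
  have := DFunLike.congr_fun h' 0
  norm_num at this

lemma lift_commutatorWord_markedFamily {p q : I ≃o I} (hpq : ¬ Commute p q) (S : Set ℕ) (m : ℕ) :
    FreeGroup.lift (equalSquaresTriple (extendAut (translation 1))
      (extendAut (blockAut (markedFamily p q S)))) (commutatorWord (m + 1)) = 1 ↔ m ∉ S := by
  have conj : ∀ (j : ℤ) (h : ℤ → (I ≃o I)),
      Commute (blockAut h) (translation j * blockAut h * (translation j)⁻¹) ↔
        ∀ n, Commute (h n) (h (n - j)) := by
    intro j h
    rw [translation_conj_blockAut, Commute, SemiconjBy, ← map_mul, ← map_mul,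
      blockAut_injective.eq_iff]
    exact funext_iff
  have hp : translation 1 ^ (m + 1) = translation ((m + 1 : ℤ) : ℝ) := by
    rw [translation_one_pow]; push_cast; rfl
  have hn : (translation 1 ^ (m + 1))⁻¹ = translation ((-(m + 1) : ℤ) : ℝ) := by
    rw [hp, translation_inv]; push_cast; rfl
  have commute_ext : ∀ x y, Commute (extendAut x) (extendAut y) ↔ Commute x y := fun x y => by
    simp only [Commute, SemiconjBy, ← map_mul, extendAut_injective.eq_iff]
  have iff1 : Commute (blockAut (markedFamily p q S)) (translation 1 ^ (m + 1) *
      blockAut (markedFamily p q S) * (translation 1 ^ (m + 1))⁻¹) ↔ m ∉ S := by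
    rw [hp, conj, commute_markedFamily_iff hpq]
  have iff2 : Commute (blockAut (markedFamily p q S)) ((translation 1 ^ (m + 1))⁻¹ *
      blockAut (markedFamily p q S) * translation 1 ^ (m + 1)) ↔ m ∉ S := by
    rw [← inv_inv (translation 1 ^ (m + 1)), hn, inv_inv, conj,
      ← commute_markedFamily_iff hpq]
    -- Shifting backwards gives the same pairs, reindexed and in the opposite order.
    constructor
    · intro h n
      simpa only [sub_neg_eq_add, sub_add_cancel] using (h (n - (m + 1))).symm
    · intro h n
      simpa only [sub_neg_eq_add, add_sub_cancel_right] using (h (n - -(m + 1))).symm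
  rw [lift_commutatorWord_eq_one, commute_alternating_iff]
  all_goals simp only [← map_pow, ← map_inv, ← map_mul, commute_ext]
  · exact iff1
  · rw [iff1, iff2]

/-! ### Ping-pong on the line -/

/-- A piecewise linear automorphism of `I` that moves all points outside `[3/8, 5/8)` close to the
end points. -/
noncomputable def stretch : I ≃o I :=
  StrictMono.orderIsoOfRightInverse
    (fun x => ⟨max (x / 3) (min (3 * x - 1) ((x + 2) / 3)), le_max_of_le_left (by linarith [x.2.1]),
      max_le (by linarith [x.2.2]) (min_le_of_right_le (by linarith [x.2.2]))⟩)
    (by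
      intro x y hxy
      have h : (x : ℝ) < y := hxy
      exact Subtype.mk_lt_mk.2 (max_lt_max (by linarith) (min_lt_min (by linarith) (by linarith))))
    (fun y => ⟨min (3 * y) (max ((y + 1) / 3) (3 * y - 2)),
      le_min (by linarith [y.2.1]) (le_max_of_le_left (by linarith [y.2.1])),
      min_le_of_right_le (max_le (by linarith [y.2.2]) (by linarith [y.2.2]))⟩)
    (by
      intro y
      ext
      simp only [min_def, max_def]
      split_ifs <;> linarith)

/-- The union of the arcs of length `1 / 4` around the points of `c + ℤ`. -/
def arcs (c : ℝ) : Set ℝ := {x | ∃ n : ℤ, n + c - 1 / 8 ≤ x ∧ x < n + c + 1 / 8}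

lemma disjoint_arcs {c d : ℝ} (h : 1 / 4 ≤ d - c) (h' : d - c ≤ 3 / 4) :
    Disjoint (arcs c) (arcs d) := by
  rw [disjoint_left]
  rintro x ⟨n, h1, h2⟩ ⟨m, h3, h4⟩
  have h5 : (n : ℝ) < m + 1 := by linarith
  have h6 : (m : ℝ) < n := by linarith
  norm_cast at h5 h6
  omega

lemma add_mem_arcs {c d x : ℝ} : x + d ∈ arcs (c + d) ↔ x ∈ arcs c := by
  refine exists_congr fun n => and_congr ?_ ?_ <;> constructor <;> intro h <;> linarith

/-- `stretch` has slope 1/3 outside the middle interval, so it contracts $[0,3/8]$ to $[0,1/8]$ and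
$[5/8,1]$ to $[7/8,1]$. -/
lemma blockAut_stretch_mem_arcs {x : ℝ} (hx : x ∉ arcs (1 / 2)) :
    blockAut (fun _ => stretch) x ∈ arcs 0 := by
  obtain ⟨n, y, hy, rfl⟩ := exists_int_add x
  have h1 : (stretch y : ℝ) < 1 := orderAut_lt_one _ hy
  have h0 := (stretch y).2.1
  rw [blockAut_int_add _ _ _ hy]
  rcases lt_or_ge (y : ℝ) (3 / 8) with h | h
  · have : (stretch y : ℝ) < 1 / 8 :=
      max_lt (by linarith) (min_lt_of_left_lt (by linarith))
    exact ⟨n, by linarith, by linarith⟩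
  · have h' : 5 / 8 ≤ (y : ℝ) := by
      by_contra! h'
      exact hx ⟨n, by linarith, by linarith⟩
    have : 7 / 8 ≤ (stretch y : ℝ) :=
      le_max_of_le_right (le_min (by linarith) (by linarith))
    -- The right end of block `n` lies in the arc around the next integer.
    exact ⟨n + 1, by push_cast; linarith, by push_cast; linarith⟩

/-- Two automorphisms of the line that play ping-pong. -/
noncomputable def pingPongPair (i : Fin 2) : ℝ ≃o ℝ :=
  translation (i / 4) * blockAut (fun _ => stretch) * (translation (i / 4))⁻¹

lemma pingPongPair_mem_arcs (i : Fin 2) {x : ℝ} (hx : x ∉ arcs (1 / 2 + i / 4)) :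
    pingPongPair i x ∈ arcs (0 + i / 4) := by
  rw [pingPongPair, translation_inv]
  simp only [RelIso.mul_apply, translation_apply, add_mem_arcs]
  apply blockAut_stretch_mem_arcs
  rwa [← add_mem_arcs (d := i / 4), neg_add_cancel_right]

/-- The attracting arcs have centres 0 and 1/4 modulo 1, the repelling ones 1/2 and 3/4. Being
half-open of length 1/4, the four families are disjoint. -/
lemma lift_pingPongPair_injective : Function.Injective (FreeGroup.lift pingPongPair) := by
  refine FreeGroup.injective_lift_of_ping_pong (α := ℝ) pingPongPair
    (fun i => arcs (0 + i / 4)) (fun i => arcs (1 / 2 + i / 4)) ?_ ?_ ?_ ?_ ?_ ?_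
  · exact fun i => ⟨0 + i / 4, 0, by simp, by simp⟩
  · intro i j hij
    fin_cases i <;> fin_cases j <;> first | exact absurd rfl hij | skip
    · exact disjoint_arcs (by norm_num) (by norm_num)
    · exact (disjoint_arcs (by norm_num) (by norm_num)).symm
  · intro i j hij
    fin_cases i <;> fin_cases j <;> first | exact absurd rfl hij | skip
    · exact disjoint_arcs (by norm_num) (by norm_num)
    · exact (disjoint_arcs (by norm_num) (by norm_num)).symm
  · intro i j
    fin_cases i <;> fin_cases j <;> exact disjoint_arcs (by norm_num) (by norm_num)
  · rintro i _ ⟨x, hx, rfl⟩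
    exact pingPongPair_mem_arcs i hx
  · rintro i _ ⟨x, hx, rfl⟩
    by_contra h
    have := pingPongPair_mem_arcs i h
    simp only [Pi.inv_apply] at this
    exact hx (by simpa using this)

/-- Block 0 is even, so evaluation there recovers `u`. -/
lemma lift_alternating_injective {A ι : Type*} [Group A] {u : ι → A}
    (hu : Function.Injective (FreeGroup.lift u)) :
    Function.Injective (FreeGroup.lift fun i => alternating (u i)) := by
  have : FreeGroup.lift u =
      (Pi.evalMonoidHom _ (0 : ℤ)).comp (FreeGroup.lift fun i => alternating (u i)) := by
    ext i; simp [alternating]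
  rw [this, MonoidHom.coe_comp] at hu
  exact hu.of_comp

lemma lift_comp_injective {A B ι : Type*} [Group A] [Group B] {φ : A →* B}
    (hφ : Function.Injective φ) {u : ι → A} (hu : Function.Injective (FreeGroup.lift u)) :
    Function.Injective (FreeGroup.lift fun i => φ (u i)) := by
  have : FreeGroup.lift (fun i => φ (u i)) = φ.comp (FreeGroup.lift u) := by ext i; simp
  rw [this]
  exact hφ.comp hu

lemma containsNonabelianFreeGroup_of_lift_injective {Γ ι : Type*} [Group Γ] [Nontrivial ι]
    {G : Subgroup Γ} {u : ι → Γ} (hu : Function.Injective (FreeGroup.lift u))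
    (hG : ∀ i, u i ∈ G) : ContainsNonabelianFreeGroup G := by
  refine ⟨(FreeGroup.lift u).range, FreeGroup.range_lift_le (range_subset_iff.2 hG),
    IsFreeGroup.ofMulEquiv (MonoidHom.ofInjective hu), fun h => ?_⟩
  obtain ⟨i, j, hij⟩ := exists_pair_ne ι
  have hcomm := congrArg Subtype.val (h ⟨_, FreeGroup.of i, rfl⟩ ⟨_, FreeGroup.of j, rfl⟩)
  have := hu ((map_mul _ _ _).trans (hcomm.trans (map_mul _ _ _).symm))
  classical
  have h2 := congrArg FreeGroup.toWord this
  simp [FreeGroup.toWord_mul, hij] at h2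

theorem corollary1p14 :
    ¬ (isoType '' {G : Subgroup HomeoPlus | IsThreeGeneratedWithCyclicSquares G}).Countable ∧
    ∃ G : Subgroup HomeoPlus,
      IsThreeGeneratedWithCyclicSquares G ∧ ContainsNonabelianFreeGroup G := by
  constructor
  · obtain ⟨p, q, hpq⟩ := exists_not_commute
    have : Uncountable (Set ℕ) := by
      rw [← not_countable_iff]
      intro h
      obtain ⟨f, hf⟩ := exists_surjective_nat (Set ℕ)
      exact Function.cantor_surjective f hf
    refine not_countable_isoType _ (fun S : Set ℕ => equalSquaresTriple (extendAut (translation 1))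
      (extendAut (blockAut (markedFamily p q S))))
      (fun S => isThreeGeneratedWithCyclicSquares_equalSquaresTriple _ _) fun S S' h => ?_
    ext m
    have := h (commutatorWord (m + 1))
    rw [lift_commutatorWord_markedFamily hpq, lift_commutatorWord_markedFamily hpq] at this
    exact not_iff_not.1 this
  · let u : Fin 2 → (I ≃o I) := fun i => extendAut (pingPongPair i)
    refine ⟨_, isThreeGeneratedWithCyclicSquares_equalSquaresTriple (u 0) (u 1),
      containsNonabelianFreeGroup_of_lift_injective
        (lift_comp_injective blockToHomeoPlus_injective (lift_alternating_injective
          (lift_comp_injective extendAut_injective lift_pingPongPair_injective))) ?_⟩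
    have mem : ∀ j, equalSquaresTriple (u 0) (u 1) j ∈
        Subgroup.closure (range (equalSquaresTriple (u 0) (u 1))) :=
      fun j => Subgroup.subset_closure (mem_range_self j)
    intro i
    fin_cases i
    · exact equalSquaresTriple_zero_inv_mul_one (u 0) (u 1) ▸ mul_mem (inv_mem (mem 0)) (mem 1)
    · exact equalSquaresTriple_zero_inv_mul_two (u 0) (u 1) ▸ mul_mem (inv_mem (mem 0)) (mem 2)
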